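/- \textbf{Setting.} Let $V$ be a finite set with $N=|V|$, and let $G_1=(V,E_1)$, $G_2=(V,E_2)$ be directed graphs (loops allowed), the two layers of a duplex network. The bipartite representation $\mathcal B_\ell$ of $G_\ell$ has vertex set $V^+\sqcup V^-$ (two copies of $V$) and an edge $\{u^+,v^-\}$ for every $(u,v)\in E_\ell$. A matching $M$ of $\mathcal B_\ell$ is a set of pairwise vertex-disjoint edges; its driver set is $D(M)=\{v\in V: v^-\text{ is not covered by }M\}$. For a budget $k_\ell\in\mathbb N$ let $\mathcal M_\ell(k_\ell)$ be the set of matchings $M$ of $\mathcal B_\ell$ with $|M|=N-k_\ell$. The budget $k_\ell$ is called minimum if $k_\ell=N-|M_\ell^*|$ for a maximum matching $M_\ell^*$ of $\mathcal B_\ell$. For a state $(M_1,M_2)\in\mathcal M_1(k_1)\times\mathcal M_2(k_2)$ put $D_\ell=D(M_\ell)$, $\mathrm{DD}_1=D_1\setminus D_2$, $\mathrm{DD}_2=D_2\setminus D_1$, $\Delta(M_1,M_2)=|\mathrm{DD}_1|+|\mathrm{DD}_2|$ and $U(M_1,M_2)=D_1\cup D_2$. A simple path in $\mathcal B_\ell$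 is $M_\ell$-alternating if its edges alternate between belonging and not belonging to $M_\ell$. An ordered pair $(u,v)$ of nodes is an admissible segment in layer $\ell$, written $u\xrightarrow{\ell}v$, if there is an $M_\ell$-alternating path in $\mathcal B_\ell$ between $u^-$ and $v^-$ and moreover $u\in D_1$, $v\notin D_1$ if $\ell=1$, respectively $u\notin D_2$, $v\in D_2$ if $\ell=2$. A cross-layer augmenting path (CLAP) from $\mathrm{DD}_1$ to $\mathrm{DD}_2$ is a sequence of admissible segments $v_0\xrightarrow{\ell_1}v_1\xrightarrow{\ell_2}\cdots\xrightarrow{\ell_k}v_k$ with $v_0\in\mathrm{DD}_1$, $v_k\in\mathrm{DD}_2$, $\ell_{i+1}\neq\ell_i$ for $1\le i<k$, and $v_0,\dots,v_k$ pairwise distinct; the first layer $\ell_1$ may be $1$ or $2$. \textbf{Theorem (CLAP-or-Optimal).} Let $(M_1,M_2)\in\mathcal M_1(k_1)\times\mathcal M_2(k_2)$ and consider \begin{enumerate} \item there is no CLAP from $\mathrm{DD}_1$ to $\mathrm{DD}_2$; \item $\Delta(M_1,M_2)$ is minimal over $\mathcal M_1(k_1)\times\mathcal M_2(k_2)$;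 \item $|U(M_1,M_2)|$ is minimal over $\mathcal M_1(k_1)\times\mathcal M_2(k_2)$. \end{enumerate} If $k_1$ and $k_2$ are the minimum budgets of their layers (that is, $M_1$ and $M_2$ are maximum matchings), then (1), (2) and (3) are equivalent. For arbitrary budgets, (2) and (3) are equivalent, and they imply (1). -/

import Mathlib

/-! Structural controllability of duplex networks: bipartite representation, matchings, driver
sets, and cross-layer augmenting paths. -/

namespace Duplex

variable {V : Type*}

/-- The bipartite representation of a directed graph `G` (loops allowed): the vertex `u⁺` is
`Sum.inl u`, the vertex `v⁻` is `Sum.inr v`, and `u⁺` is joined to `v⁻` iff `(u, v)` is an edge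
of `G`. -/
def bipartiteRep (G : Digraph V) : SimpleGraph (V ⊕ V) where
  Adj x y := (∃ u v, x = Sum.inl u ∧ y = Sum.inr v ∧ G.Adj u v) ∨
    (∃ u v, x = Sum.inr v ∧ y = Sum.inl u ∧ G.Adj u v)
  symm := ⟨by
    rintro x y (⟨u, v, hx, hy, h⟩ | ⟨u, v, hx, hy, h⟩)
    · exact Or.inr ⟨u, v, hy, hx, h⟩
    · exact Or.inl ⟨u, v, hy, hx, h⟩⟩
  loopless := ⟨by
    rintro x (⟨u, v, hx, hy, -⟩ | ⟨u, v, hx, hy, -⟩)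
    · exact absurd (hx.symm.trans hy) (by simp)
    · exact absurd (hx.symm.trans hy) (by simp)⟩

/-- A matching of the bipartite representation of `G`: a set of edges, no two of which share a
vertex. -/
def IsMatching (G : Digraph V) (M : Set (Sym2 (V ⊕ V))) : Prop :=
  M ⊆ (bipartiteRep G).edgeSet ∧
    ∀ e ∈ M, ∀ f ∈ M, ∀ x, x ∈ e → x ∈ f → e = f

/-- A matching of largest possible size. -/
def IsMaximumMatching (G : Digraph V) (M : Set (Sym2 (V ⊕ V))) : Prop :=
  IsMatching G M ∧ ∀ M', IsMatching G M' → M'.ncard ≤ M.ncard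

/-- The vertices incident to an edge of `M`. -/
def saturated (M : Set (Sym2 (V ⊕ V))) : Set (V ⊕ V) :=
  {x | ∃ e ∈ M, x ∈ e}

/-- The driver set `D(M)`: the nodes `v` whose copy `v⁻` is unmatched. -/
def driverSet (M : Set (Sym2 (V ⊕ V))) : Set V :=
  {v | Sum.inr v ∉ saturated M}

/-- The feasible set for budget `k`: all matchings `M` with `|M| = N - k`, where `N = |V|`. -/
def feasibleSet (G : Digraph V) (k : ℕ) : Set (Set (Sym2 (V ⊕ V))) :=
  {M | IsMatching G M ∧ M.ncard + k = Nat.card V}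

/-- `k` is the minimum driver budget of `G`: `k = N - |M*|` for a maximum matching `M*`. -/
def IsMinimumBudget (G : Digraph V) (k : ℕ) : Prop :=
  ∃ Mstar, IsMaximumMatching G Mstar ∧ Mstar.ncard + k = Nat.card V

/-- `DD₁ = D₁ \ D₂`. -/
def DD₁ (M₁ M₂ : Set (Sym2 (V ⊕ V))) : Set V := driverSet M₁ \ driverSet M₂

/-- `DD₂ = D₂ \ D₁`. -/
def DD₂ (M₁ M₂ : Set (Sym2 (V ⊕ V))) : Set V := driverSet M₂ \ driverSet M₁

/-- The difference mass `Δ(M₁, M₂) = |DD₁| + |DD₂|`. -/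
noncomputable def diffMass (M₁ M₂ : Set (Sym2 (V ⊕ V))) : ℕ :=
  (DD₁ M₁ M₂).ncard + (DD₂ M₁ M₂).ncard

/-- The union driver set `U(M₁, M₂) = D₁ ∪ D₂`. -/
def unionDriverSet (M₁ M₂ : Set (Sym2 (V ⊕ V))) : Set V :=
  driverSet M₁ ∪ driverSet M₂

/-- A walk in the bipartite representation is an `M`-alternating path if it is a simple path and
of any two consecutive edges exactly one lies in `M`. -/
def IsAlternatingPath {G : Digraph V} (M : Set (Sym2 (V ⊕ V))) {x y : V ⊕ V}
    (p : (bipartiteRep G).Walk x y) : Prop :=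
  p.IsPath ∧ p.edges.IsChain (fun e f => e ∈ M ↔ f ∉ M)

/-- The two layers of a duplex network. -/
inductive Layer
  | one
  | two

/-- `(u, v)` is an admissible segment in layer `ℓ`. -/
def AdmissibleSegment (G₁ G₂ : Digraph V) (M₁ M₂ : Set (Sym2 (V ⊕ V))) :
    Layer → V → V → Prop
  | Layer.one, u, v => u ∈ driverSet M₁ ∧ v ∉ driverSet M₁ ∧
      ∃ p : (bipartiteRep G₁).Walk (Sum.inr u) (Sum.inr v), IsAlternatingPath M₁ p
  | Layer.two, u, v => u ∉ driverSet M₂ ∧ v ∈ driverSet M₂ ∧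
      ∃ p : (bipartiteRep G₂).Walk (Sum.inr u) (Sum.inr v), IsAlternatingPath M₂ p

/-- The nodes `v 0, …, v k`, with a segment in layer `ℓ i` from the `i`-th node to the next one,
form a cross-layer augmenting path from `DD₁` to `DD₂`. -/
structure IsCLAP (G₁ G₂ : Digraph V) (M₁ M₂ : Set (Sym2 (V ⊕ V))) {k : ℕ}
    (v : Fin (k + 1) → V) (ℓ : Fin k → Layer) : Prop where
  segment : ∀ i : Fin k, AdmissibleSegment G₁ G₂ M₁ M₂ (ℓ i) (v i.castSucc) (v i.succ)
  start_mem : v 0 ∈ DD₁ M₁ M₂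
  end_mem : v (Fin.last k) ∈ DD₂ M₁ M₂
  alternating : ∀ i j : Fin k, (i : ℕ) + 1 = (j : ℕ) → ℓ i ≠ ℓ j
  distinct : Function.Injective v

/-- There is a cross-layer augmenting path from `DD₁` to `DD₂` in the state `(M₁, M₂)`. -/
def ExistsCLAP (G₁ G₂ : Digraph V) (M₁ M₂ : Set (Sym2 (V ⊕ V))) : Prop :=
  ∃ (k : ℕ) (v : Fin (k + 1) → V) (ℓ : Fin k → Layer), IsCLAP G₁ G₂ M₁ M₂ v ℓ

/-- `Δ(M₁, M₂)` is minimal over the feasible set for the budgets `(k₁, k₂)`. -/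
def DiffMassMinimal (G₁ G₂ : Digraph V) (k₁ k₂ : ℕ) (M₁ M₂ : Set (Sym2 (V ⊕ V))) : Prop :=
  IsMinOn (fun S : Set (Sym2 (V ⊕ V)) × Set (Sym2 (V ⊕ V)) => diffMass S.1 S.2)
    (feasibleSet G₁ k₁ ×ˢ feasibleSet G₂ k₂) (M₁, M₂)

/-- `|U(M₁, M₂)|` is minimal over the feasible set for the budgets `(k₁, k₂)`. -/
def UnionMinimal (G₁ G₂ : Digraph V) (k₁ k₂ : ℕ) (M₁ M₂ : Set (Sym2 (V ⊕ V))) : Prop :=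
  IsMinOn (fun S : Set (Sym2 (V ⊕ V)) × Set (Sym2 (V ⊕ V)) => (unionDriverSet S.1 S.2).ncard)
    (feasibleSet G₁ k₁ ×ˢ feasibleSet G₂ k₂) (M₁, M₂)

end Duplex

/-! All feasible matchings of layer `i` have exactly `kᵢ` drivers. Hence `2|U| = Δ + k₁ + k₂`, so
the two kinds of minimality coincide, and `|DD₁| - |DD₂| = k₁ - k₂`, so lowering `|DD₁|` lowers `Δ`.

Flipping a layer-1 segment from `u` to `v` replaces `u` by `v` in `D₁`; flipping a layer-2 segment
replaces `v` by `u` in `D₂`. Along a CLAP the inner nodes enter or leave both driver sets together,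
so only the ends change status and `Δ` drops. Segments of one layer may cross each other, so the
flip is made along a repetition-free path in `V × Layer` instead (`exists_augmented_pairings`).

Conversely, let `X` be the set of nodes reachable from `DD₁` by admissible segments. Without a CLAP
it misses `DD₂`, so `|DD₁| = |D₁ ∩ X| - |D₂ ∩ X|`. A maximum matching has the fewest drivers in a
set closed under its alternating paths (`IsPairing.ncard_inter_le`). Applied to `X` in layer 1 and
to `Xᶜ` in layer 2, this shows that any competitor `(N₁, N₂)` has at least as many nodes in `D(N₁) \
D(N₂)`. -/

namespace Duplex

variable {V : Type*}

open Relation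

/-! ### Matchings encoded by driver sets and partner functions -/

/-- A matching of the bipartite representation of `G`, encoded by its driver set `D` and the
function `m` which sends a node `w ∉ D` to the node `m w` such that `(m w)⁺` is matched to
`w⁻`. -/
structure IsPairing (G : Digraph V) (D : Set V) (m : V → V) : Prop where
  injOn : Set.InjOn m Dᶜ
  adj : ∀ w, w ∉ D → G.Adj (m w) w

/-- The matching encoded by a driver set and a partner function. -/
def pairingEdges (D : Set V) (m : V → V) : Set (Sym2 (V ⊕ V)) :=
  {e | ∃ w, w ∉ D ∧ e = s(Sum.inl (m w), Sum.inr w)}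

lemma bipartiteRep_adj_inl_inr {G : Digraph V} {u v : V} :
    (bipartiteRep G).Adj (Sum.inl u) (Sum.inr v) ↔ G.Adj u v := by
  simp [bipartiteRep]

lemma mk_mem_pairingEdges {D : Set V} {m : V → V} {z w : V} :
    s(Sum.inl z, Sum.inr w) ∈ pairingEdges D m ↔ w ∉ D ∧ m w = z := by
  simp only [pairingEdges, Set.mem_ofPred_eq, Sym2.eq_iff]
  constructor
  · rintro ⟨w', hw', ⟨h1, h2⟩ | ⟨h1, -⟩⟩
    · cases h1; cases h2; exact ⟨hw', rfl⟩
    · cases h1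
  · rintro ⟨hw, rfl⟩
    exact ⟨w, hw, Or.inl ⟨rfl, rfl⟩⟩

lemma IsPairing.isMatching {G : Digraph V} {D : Set V} {m : V → V} (h : IsPairing G D m) :
    IsMatching G (pairingEdges D m) := by
  constructor
  · rintro e ⟨w, hw, rfl⟩
    exact bipartiteRep_adj_inl_inr.2 (h.adj w hw)
  · rintro e ⟨w, hw, rfl⟩ f ⟨w', hw', rfl⟩ x hx hx'
    have key : w = w' := by
      rw [Sym2.mem_iff] at hx hx'
      rcases hx with rfl | rfl <;> rcases hx' with hx' | hx'
      · exact h.injOn hw hw' (Sum.inl.inj hx')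
      · cases hx'
      · cases hx'
      · exact Sum.inr.inj hx'
    rw [key]

lemma driverSet_pairingEdges (D : Set V) (m : V → V) : driverSet (pairingEdges D m) = D := by
  ext v
  simp only [driverSet, saturated, pairingEdges, Set.mem_ofPred_eq, not_exists, not_and]
  constructor
  · intro h
    by_contra hv
    exact h _ ⟨v, hv, rfl⟩ (Sym2.mem_mk_right _ _)
  · rintro hv e ⟨w, hw, rfl⟩ hm
    rcases Sym2.mem_iff.1 hm with h | h
    · cases h
    · cases h; exact hw hv

lemma ncard_pairingEdges (D : Set V) (m : V → V) : (pairingEdges D m).ncard = Dᶜ.ncard := by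
  have : pairingEdges D m = (fun w => s(Sum.inl (m w), Sum.inr w)) '' Dᶜ := by
    ext e
    simp only [pairingEdges, Set.mem_ofPred_eq, Set.mem_image, Set.mem_compl_iff, eq_comm]
  rw [this, Set.InjOn.ncard_image]
  intro w _ w' _ h
  rcases Sym2.eq_iff.1 h with ⟨-, h⟩ | ⟨h, -⟩
  · exact Sum.inr.inj h
  · cases h

lemma IsMatching.exists_pairing {G : Digraph V} {M : Set (Sym2 (V ⊕ V))} (hM : IsMatching G M) :
    ∃ m, IsPairing G (driverSet M) m ∧ M = pairingEdges (driverSet M) m := by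
  classical
  have hform : ∀ e ∈ M, ∃ z w, e = s(Sum.inl z, Sum.inr w) ∧ G.Adj z w := by
    intro e he
    have := hM.1 he
    induction e using Sym2.ind with
    | _ x y =>
      rcases this with ⟨u, v, rfl, rfl, h⟩ | ⟨u, v, rfl, rfl, h⟩
      · exact ⟨u, v, rfl, h⟩
      · exact ⟨u, v, Sym2.eq_swap, h⟩
  have hex : ∀ w, ∃ z, w ∉ driverSet M → s(Sum.inl z, Sum.inr w) ∈ M := by
    intro w
    by_cases hw : w ∈ driverSet M
    · exact ⟨w, fun h => absurd hw h⟩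
    · obtain ⟨e, he, hwe⟩ := not_not.1 hw
      obtain ⟨z, w', rfl, -⟩ := hform e he
      rcases Sym2.mem_iff.1 hwe with h | h
      · cases h
      · cases h; exact ⟨z, fun _ => he⟩
  choose m hm using hex
  have heq : ∀ e ∈ M, ∀ f ∈ M, ∀ x, x ∈ e → x ∈ f → e = f := hM.2
  refine ⟨m, ⟨?_, ?_⟩, ?_⟩
  · intro w hw w' hw' h
    have := heq _ (hm w hw) _ (hm w' hw') (Sum.inl (m w)) (Sym2.mem_mk_left _ _)
      (by rw [h]; exact Sym2.mem_mk_left _ _)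
    rcases Sym2.eq_iff.1 this with ⟨-, h⟩ | ⟨h, -⟩
    · exact Sum.inr.inj h
    · cases h
  · intro w hw
    exact bipartiteRep_adj_inl_inr.1 (hM.1 (hm w hw))
  · ext e
    constructor
    · intro he
      obtain ⟨z, w, rfl, -⟩ := hform e he
      have hw : w ∉ driverSet M := not_not.2 ⟨_, he, Sym2.mem_mk_right _ _⟩
      refine ⟨w, hw, heq _ he _ (hm w hw) (Sum.inr w) (Sym2.mem_mk_right _ _)
        (Sym2.mem_mk_right _ _)⟩
    · rintro ⟨w, hw, rfl⟩
      exact hm w hw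

/-- Each matching edge covers exactly one minus copy. A budget therefore prescribes the number of
drivers. -/
lemma IsMatching.ncard_add_ncard_driverSet [Finite V] {G : Digraph V} {M : Set (Sym2 (V ⊕ V))}
    (hM : IsMatching G M) : M.ncard + (driverSet M).ncard = Nat.card V := by
  obtain ⟨m, -, h⟩ := hM.exists_pairing
  have h2 : M.ncard = (driverSet M)ᶜ.ncard := by
    conv_lhs => rw [h]
    exact ncard_pairingEdges _ _
  rw [h2, add_comm, Set.ncard_add_ncard_compl]

lemma mem_feasibleSet_iff [Finite V] {G : Digraph V} {k : ℕ} {M : Set (Sym2 (V ⊕ V))} :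
    M ∈ feasibleSet G k ↔ IsMatching G M ∧ (driverSet M).ncard = k := by
  constructor
  · rintro ⟨h1, h2⟩
    have := h1.ncard_add_ncard_driverSet
    exact ⟨h1, by omega⟩
  · rintro ⟨h1, h2⟩
    have := h1.ncard_add_ncard_driverSet
    exact ⟨h1, by omega⟩

lemma IsPairing.mem_feasibleSet [Finite V] {G : Digraph V} {D : Set V} {m : V → V}
    (h : IsPairing G D m) : pairingEdges D m ∈ feasibleSet G D.ncard :=
  mem_feasibleSet_iff.2 ⟨h.isMatching, by rw [driverSet_pairingEdges]⟩

/-! ### Alternating steps, exchange and augmentation -/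

/-- One step of an alternating path from `u⁻` to `w⁻`: a non-matching edge from `u⁻` to the
partner `(m w)⁺` of `w⁻`, followed by the matching edge at `w⁻`. -/
def AltStep (G : Digraph V) (D : Set V) (m : V → V) (u w : V) : Prop :=
  w ∉ D ∧ G.Adj (m w) u

/-- Rerouting a pairing along a partial injection made of alternating steps, each of which starts
at a driver node or where another one ends. -/
lemma IsPairing.exchange [Finite V] {G : Digraph V} {D : Set V} {m : V → V}
    (h : IsPairing G D m) (E : V → V → Prop) (hfun : ∀ x y y', E x y → E x y' → y = y')
    (hinj : ∀ x x' y, E x y → E x' y → x = x') (hstep : ∀ x y, E x y → AltStep G D m x y)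
    (hsrc : ∀ x y, E x y → x ∈ D ∨ ∃ x', E x' x) :
    ∃ m', IsPairing G {x | (x ∈ D ∨ ∃ x', E x' x) ∧ ¬ ∃ y, E x y} m' ∧
      {x | (x ∈ D ∨ ∃ x', E x' x) ∧ ¬ ∃ y, E x y}.ncard = D.ncard ∧
      m' '' {x | (x ∈ D ∨ ∃ x', E x' x) ∧ ¬ ∃ y, E x y}ᶜ = m '' Dᶜ := by
  classical
  set D' : Set V := {x | (x ∈ D ∨ ∃ x', E x' x) ∧ ¬ ∃ y, E x y} with hD'
  -- `σ` sends a source of `E` to its target and fixes every other node; the new partner function is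
  -- `m ∘ σ`.
  have hσ : ∀ x, ∃ y, E x y ∨ ((¬ ∃ y, E x y) ∧ y = x) := by
    intro x
    by_cases hx : ∃ y, E x y
    · exact ⟨hx.choose, Or.inl hx.choose_spec⟩
    · exact ⟨x, Or.inr ⟨hx, rfl⟩⟩
  choose σ hσ using hσ
  have hmem : ∀ x, x ∉ D' ↔ (∃ y, E x y) ∨ (x ∉ D ∧ ¬ ∃ x', E x' x) := by
    intro x
    simp only [hD', Set.mem_ofPred_eq]
    tauto
  have hbij : Set.BijOn σ D'ᶜ Dᶜ := by
    refine ⟨?_, ?_, ?_⟩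
    · intro x hx
      rcases hσ x with h1 | ⟨h1, h2⟩
      · exact (hstep _ _ h1).1
      · rw [h2]
        rcases (hmem x).1 hx with h3 | h3
        · exact absurd h3 h1
        · exact h3.1
    · intro x hx x' hx' hxx
      rcases hσ x with h1 | ⟨h1, h2⟩ <;> rcases hσ x' with h1' | ⟨h1', h2'⟩
      · exact hinj _ _ _ h1 (hxx ▸ h1')
      · rcases (hmem x').1 hx' with h3 | h3
        · exact absurd h3 h1'
        · exact absurd ⟨x, by rwa [hxx, h2'] at h1⟩ h3.2
      · rcases (hmem x).1 hx with h3 | h3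
        · exact absurd h3 h1
        · exact absurd ⟨x', by rwa [← hxx, h2] at h1'⟩ h3.2
      · rw [← h2, ← h2', hxx]
    · intro y hy
      by_cases hT : ∃ x, E x y
      · obtain ⟨x, hx⟩ := hT
        refine ⟨x, (hmem x).2 (Or.inl ⟨y, hx⟩), ?_⟩
        rcases hσ x with h1 | ⟨h1, -⟩
        · exact hfun _ _ _ h1 hx
        · exact absurd ⟨y, hx⟩ h1
      · refine ⟨y, (hmem y).2 (Or.inr ⟨hy, hT⟩), ?_⟩
        rcases hσ y with h1 | ⟨-, h1⟩
        -- A node outside `D` that is not a target is not a source either, so `σ` fixes it.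
        · rcases hsrc _ _ h1 with h2 | h2
          · exact absurd h2 hy
          · exact absurd h2 hT
        · exact h1
  refine ⟨m ∘ σ, ⟨h.injOn.comp hbij.injOn hbij.mapsTo, ?_⟩, ?_, ?_⟩
  · intro x hx
    have h0 := hbij.mapsTo hx
    rcases hσ x with h1 | ⟨-, h1⟩
    · exact (hstep _ _ h1).2
    · rw [Function.comp_apply, h1]
      rw [h1] at h0
      exact h.adj x h0
  · have h1 : D'ᶜ.ncard = Dᶜ.ncard := by
      rw [← hbij.image_eq, hbij.injOn.ncard_image]
    have h2 := Set.ncard_add_ncard_compl D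
    have h3 := Set.ncard_add_ncard_compl D'
    omega
  · rw [Set.image_comp, hbij.image_eq]

/-- Reachable points are reached by a sequence without repetition. -/
lemma exists_injOn_of_reflTransGen {α : Type*} {r : α → α → Prop} {a b : α}
    (h : Relation.ReflTransGen r a b) :
    ∃ (n : ℕ) (p : ℕ → α), p 0 = a ∧ p n = b ∧ (∀ i < n, r (p i) (p (i + 1))) ∧
      ∀ i ≤ n, ∀ j ≤ n, p i = p j → i = j := by
  classical
  have hex : ∃ (n : ℕ) (p : ℕ → α), p 0 = a ∧ p n = b ∧ ∀ i < n, r (p i) (p (i + 1)) := by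
    induction h with
    | refl => exact ⟨0, fun _ => a, rfl, rfl, by simp⟩
    | @tail c d _ hcd ih =>
      obtain ⟨n, p, h0, hn, hp⟩ := ih
      refine ⟨n + 1, fun i => if i ≤ n then p i else d, by simp [h0], by simp, ?_⟩
      intro i hi
      rcases Nat.lt_succ_iff_lt_or_eq.1 hi with hi | rfl
      · simpa [hi.le, Nat.succ_le_of_lt hi] using hp i hi
      · simpa [hn] using hcd
  obtain ⟨p, h0, hn, hp⟩ := Nat.find_spec hex
  refine ⟨Nat.find hex, p, h0, hn, hp, ?_⟩
  have key : ∀ i j, i < j → j ≤ Nat.find hex → p i ≠ p j := by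
    intro i j hij hj hpp
    -- If `p i = p j`, cutting out the stretch between `i` and `j` gives a sequence shorter than the
    -- shortest one.
    refine Nat.find_min hex (m := Nat.find hex - (j - i)) (by omega)
      ⟨fun t => if t ≤ i then p t else p (t + (j - i)), by simp [h0], ?_, ?_⟩
    · by_cases hc : Nat.find hex - (j - i) ≤ i
      · have h1 : Nat.find hex = j := by omega
        have h2 : Nat.find hex - (j - i) = i := by omega
        simp only [h2, le_refl, if_true]
        rw [hpp, ← h1, hn]
      · simp only [hc, if_false]
        rw [Nat.sub_add_cancel (by omega), hn]
    · intro t ht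
      rcases lt_trichotomy t i with h1 | rfl | h1
      · simpa [h1.le, Nat.succ_le_of_lt h1] using hp t (by omega)
      · have := hp j (by omega)
        simp only [le_refl, if_true, Nat.not_succ_le_self, if_false]
        rw [hpp]
        convert this using 2
        omega
      · have h2 : ¬ t ≤ i := by omega
        have h3 : ¬ t + 1 ≤ i := by omega
        simp only [h2, h3, if_false]
        convert hp (t + (j - i)) (by omega) using 2
        omega
  intro i hi j hj hpp
  rcases lt_trichotomy i j with h1 | h1 | h1
  · exact absurd hpp (key i j h1 hj)
  · exact h1
  · exact absurd hpp.symm (key j i h1 hi)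

/-- Every step ends at a matched node, so only the empty sequence can end in `D`. -/
lemma AltStep.reflTransGen_target {G : Digraph V} {D : Set V} {m : V → V} {u v : V}
    (h : ReflTransGen (AltStep G D m) u v) (hv : v ∈ D) : v = u := by
  rcases ReflTransGen.cases_tail h with h | ⟨w, -, h⟩
  · exact h
  · exact absurd hv h.1

/-- Rerouting along the steps frees `w⁻` and keeps the same plus copies matched. Then `z⁺` is still
free, and matching it to `w⁻` removes a driver. -/
lemma IsPairing.augment [Finite V] {G : Digraph V} {D : Set V} {m : V → V} (h : IsPairing G D m)
    {u w z : V} (hu : u ∈ D) (huw : ReflTransGen (AltStep G D m) u w) (hz : G.Adj z w)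
    (hzm : z ∉ m '' Dᶜ) : ∃ D' m', IsPairing G D' m' ∧ D'.ncard < D.ncard := by
  classical
  obtain ⟨n, p, h0, hn, hp, hinj⟩ := exists_injOn_of_reflTransGen huw
  obtain ⟨m', hm', hcard, himg⟩ := h.exchange
    (fun x y => ∃ i < n, p i = x ∧ p (i + 1) = y)
    (by
      rintro x y y' ⟨i, hi, rfl, rfl⟩ ⟨j, hj, hij, rfl⟩
      rw [hinj j hj.le i hi.le hij])
    (by
      rintro x x' y ⟨i, hi, rfl, rfl⟩ ⟨j, hj, rfl, hij⟩
      have := hinj (j + 1) hj (i + 1) hi hij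
      rw [show i = j by omega])
    (by
      rintro x y ⟨i, hi, rfl, rfl⟩
      exact hp i hi)
    (by
      rintro x y ⟨i, hi, rfl, rfl⟩
      rcases i with _ | i
      · left; rwa [h0]
      · right; exact ⟨p i, i, by omega, rfl, rfl⟩)
  set D' : Set V := {x | (x ∈ D ∨ ∃ x', ∃ i < n, p i = x' ∧ p (i + 1) = x) ∧
    ¬ ∃ y, ∃ i < n, p i = x ∧ p (i + 1) = y}
  have hw : w ∈ D' := by
    refine ⟨?_, ?_⟩
    · rcases n with _ | n
      · left; rwa [← hn, h0]
      · right; exact ⟨p n, n, by omega, rfl, hn⟩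
    · rintro ⟨y, i, hi, hiw, -⟩
      have := hinj i hi.le n le_rfl (hiw.trans hn.symm)
      omega
  have hzm' : z ∉ m' '' D'ᶜ := by rwa [himg]
  have hmem : ∀ x, x ∉ D' \ {w} → x ≠ w → x ∉ D' := fun x hx hxw hxD => hx ⟨hxD, hxw⟩
  refine ⟨D' \ {w}, Function.update m' w z, ⟨?_, ?_⟩, ?_⟩
  · intro x hx y hy hxy
    by_cases hxw : x = w <;> by_cases hyw : y = w
    · rw [hxw, hyw]
    · rw [hxw, Function.update_self, Function.update_of_ne hyw] at hxy
      exact absurd ⟨y, hmem y hy hyw, hxy.symm⟩ hzm'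
    · rw [hyw, Function.update_self, Function.update_of_ne hxw] at hxy
      exact absurd ⟨x, hmem x hx hxw, hxy⟩ hzm'
    · rw [Function.update_of_ne hyw, Function.update_of_ne hxw] at hxy
      exact hm'.injOn (hmem x hx hxw) (hmem y hy hyw) hxy
  · intro x hx
    by_cases hxw : x = w
    · rw [hxw, Function.update_self]; exact hz
    · rw [Function.update_of_ne hxw]; exact hm'.adj x (hmem x hx hxw)
  · rw [← hcard]
    exact Set.ncard_sdiff_singleton_lt_of_mem hw

/-- A maximum matching has the fewest drivers in a set closed under alternating paths. -/
lemma IsPairing.ncard_inter_le [Finite V] {G : Digraph V} {D : Set V} {m : V → V}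
    (h : IsPairing G D m) (hmax : ∀ D' m', IsPairing G D' m' → D.ncard ≤ D'.ncard)
    {X : Set V}
    (hX : ∀ u ∈ D, u ∈ X → ∀ v, v ∉ D → ReflTransGen (AltStep G D m) u v → v ∈ X)
    {D' : Set V} {m' : V → V} (h' : IsPairing G D' m') :
    (D ∩ X).ncard ≤ (D' ∩ X).ncard := by
  set Y : Set V := {v | ∃ u ∈ D ∩ X, ReflTransGen (AltStep G D m) u v}
  have hYX : Y ⊆ X := by
    rintro v ⟨u, ⟨hu, huX⟩, huv⟩
    by_cases hv : v ∈ D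
    · rwa [AltStep.reflTransGen_target huv hv]
    · exact hX u hu huX v hv huv
  have hle : (Y \ D').ncard ≤ (Y \ D).ncard := by
    -- By maximality the `m'`-partner of a reachable node is also used by `m`; the node it serves
    -- there is one step further, hence again in `Y`.
    have hsub : m' '' (Y \ D') ⊆ m '' (Y \ D) := by
      rintro _ ⟨w, ⟨⟨u, hu, huw⟩, hwD⟩, rfl⟩
      have hadj := h'.adj w hwD
      by_cases hz : m' w ∈ m '' Dᶜ
      · obtain ⟨x, hx, hxw⟩ := hz
        exact ⟨x, ⟨⟨u, hu, huw.tail ⟨hx, by rwa [hxw]⟩⟩, hx⟩, hxw⟩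
      · obtain ⟨D'', m'', h'', hlt⟩ := h.augment hu.1 huw hadj hz
        exact absurd (hmax D'' m'' h'') (by omega)
    calc (Y \ D').ncard = (m' '' (Y \ D')).ncard :=
          ((h'.injOn.mono fun x hx => hx.2).ncard_image).symm
      _ ≤ (m '' (Y \ D)).ncard := Set.ncard_le_ncard hsub (Set.toFinite _)
      _ ≤ (Y \ D).ncard := Set.ncard_image_le (Set.toFinite _)
  have h1 := Set.ncard_inter_add_ncard_sdiff_eq_ncard Y D (Set.toFinite _)
  have h2 := Set.ncard_inter_add_ncard_sdiff_eq_ncard Y D' (Set.toFinite _)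
  have h3 : (D ∩ X).ncard ≤ (Y ∩ D).ncard :=
    Set.ncard_le_ncard (fun x hx => ⟨⟨x, hx, .refl⟩, hx.1⟩) (Set.toFinite _)
  have h4 : (Y ∩ D').ncard ≤ (D' ∩ X).ncard :=
    Set.ncard_le_ncard (fun x hx => ⟨hx.2, hYX hx.1⟩) (Set.toFinite _)
  omega

/-! ### Alternating paths as sequences of steps -/

lemma IsAlternatingPath.reverse {G : Digraph V} {M : Set (Sym2 (V ⊕ V))} {x y : V ⊕ V}
    {p : (bipartiteRep G).Walk x y} (h : IsAlternatingPath M p) :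
    IsAlternatingPath M p.reverse := by
  refine ⟨h.1.reverse, ?_⟩
  rw [SimpleGraph.Walk.edges_reverse, List.isChain_reverse]
  exact h.2.imp fun e f hef => by tauto

/-- A step is two edges long, so the induction on the walk carries one claim for each side of the
bipartition. -/
lemma reflTransGen_of_walk {G : Digraph V} {D : Set V} {m : V → V} {v : V} {x y : V ⊕ V}
    (p : (bipartiteRep G).Walk x y)
    (hp : p.edges.IsChain (fun e f => e ∈ pairingEdges D m ↔ f ∉ pairingEdges D m))
    (hy : y = Sum.inr v) :
    (∀ u, x = Sum.inr u → (∀ e ∈ p.edges.head?, e ∉ pairingEdges D m) →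
      ReflTransGen (AltStep G D m) u v) ∧
    (∀ z, x = Sum.inl z → (∀ e ∈ p.edges.head?, e ∈ pairingEdges D m) →
      ∃ w, w ∉ D ∧ m w = z ∧ ReflTransGen (AltStep G D m) w v) := by
  induction p with
  | nil =>
    subst hy
    refine ⟨fun u hu _ => ?_, fun z hz => by cases hz⟩
    cases hu
    exact .refl
  | @cons a b c hadj q ih =>
    rw [SimpleGraph.Walk.edges_cons, List.isChain_cons] at hp
    have ih := ih hp.2 hy
    refine ⟨?_, ?_⟩
    · rintro u rfl hhead
      have hne : s(Sum.inr u, b) ∉ pairingEdges D m := hhead _ (by simp)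
      rcases hadj with ⟨_, _, h1, -, -⟩ | ⟨z, u', h1, rfl, hzu⟩
      · cases h1
      · cases h1
        obtain ⟨w, hw, rfl, hwv⟩ := ih.2 z rfl (fun e he => by
          have := hp.1 e he
          tauto)
        exact hwv.head ⟨hw, hzu⟩
    · rintro z rfl hhead
      have hin : s(Sum.inl z, b) ∈ pairingEdges D m := hhead _ (by simp)
      rcases hadj with ⟨z', w, h1, rfl, -⟩ | ⟨_, _, h1, -, -⟩
      · cases h1
        obtain ⟨hw, hmw⟩ := mk_mem_pairingEdges.1 hin
        exact ⟨w, hw, hmw, ih.1 w rfl (fun e he => by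
          have := hp.1 e he
          tauto)⟩
      · cases h1

/-- The support clauses, with injectivity of `p` and `m`, make the two prepended vertices new; the
clause on the first edge makes the glued walk alternate. -/
lemma IsPairing.exists_walk {G : Digraph V} {D : Set V} {m : V → V} (h : IsPairing G D m)
    (n : ℕ) : ∀ p : ℕ → V, (∀ i < n, AltStep G D m (p i) (p (i + 1))) →
    (∀ i ≤ n, ∀ j ≤ n, p i = p j → i = j) →
    ∃ q : (bipartiteRep G).Walk (Sum.inr (p 0)) (Sum.inr (p n)),
      IsAlternatingPath (pairingEdges D m) q ∧
      (∀ e ∈ q.edges.head?, e ∉ pairingEdges D m) ∧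
      (∀ v, Sum.inr v ∈ q.support → ∃ i ≤ n, v = p i) ∧
      ∀ z, Sum.inl z ∈ q.support → ∃ i < n, z = m (p (i + 1)) := by
  induction n with
  | zero =>
    intro p _ _
    refine ⟨.nil, ⟨.nil, by simp⟩, by simp, ?_, by simp⟩
    intro v hv
    exact ⟨0, le_rfl, by simpa using hv⟩
  | succ n ih =>
    intro p hp hinj
    obtain ⟨q, ⟨hq, hchain⟩, hhead, hr, hl⟩ := ih (fun i => p (i + 1))
      (fun i hi => hp (i + 1) (by omega))
      (fun i hi j hj hij => by have := hinj (i + 1) (by omega) (j + 1) (by omega) hij; omega)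
    obtain ⟨h1, h2⟩ := hp 0 (by omega)
    have e1 : (bipartiteRep G).Adj (Sum.inr (p 0)) (Sum.inl (m (p 1))) :=
      (bipartiteRep_adj_inl_inr.2 h2).symm
    have e2 : (bipartiteRep G).Adj (Sum.inl (m (p 1))) (Sum.inr (p (0 + 1))) :=
      bipartiteRep_adj_inl_inr.2 (h.adj _ h1)
    have hin : s(Sum.inl (m (p 1)), Sum.inr (p (0 + 1))) ∈ pairingEdges D m :=
      mk_mem_pairingEdges.2 ⟨h1, rfl⟩
    have hout : s(Sum.inr (p 0), Sum.inl (m (p 1))) ∉ pairingEdges D m := by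
      rw [Sym2.eq_swap, mk_mem_pairingEdges]
      rintro ⟨h3, h4⟩
      have := hinj 0 (by omega) 1 (by omega) (h.injOn h3 h1 h4)
      omega
    have hnl : Sum.inl (m (p 1)) ∉ q.support := by
      intro hc
      obtain ⟨i, hi, hi'⟩ := hl _ hc
      have := hinj 1 (by omega) (i + 1 + 1) (by omega)
        (h.injOn h1 (hp (i + 1) (by omega)).1 hi')
      omega
    have hnr : Sum.inr (p 0) ∉ q.support := by
      intro hc
      obtain ⟨i, hi, hi'⟩ := hr _ hc
      have := hinj 0 (by omega) (i + 1) (by omega) hi'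
      omega
    refine ⟨.cons e1 (.cons e2 q), ⟨?_, ?_⟩, ?_, ?_, ?_⟩
    · rw [SimpleGraph.Walk.cons_isPath_iff, SimpleGraph.Walk.cons_isPath_iff]
      refine ⟨⟨hq, hnl⟩, ?_⟩
      simpa using hnr
    · rw [SimpleGraph.Walk.edges_cons, SimpleGraph.Walk.edges_cons, List.isChain_cons,
        List.isChain_cons]
      refine ⟨?_, ?_, hchain⟩
      · intro e he
        simp only [List.head?_cons, Option.mem_def, Option.some.injEq] at he
        subst he
        tauto
      · intro e he
        have := hhead e he
        tauto
    · intro e he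
      simp only [SimpleGraph.Walk.edges_cons, List.head?_cons, Option.mem_def,
        Option.some.injEq] at he
      subst he
      exact hout
    · intro v hv
      simp only [SimpleGraph.Walk.support_cons, List.mem_cons, Sum.inr.injEq, reduceCtorEq,
        false_or] at hv
      rcases hv with rfl | hv
      · exact ⟨0, by omega, rfl⟩
      · obtain ⟨i, hi, rfl⟩ := hr v hv
        exact ⟨i + 1, by omega, rfl⟩
    · intro z hz
      simp only [SimpleGraph.Walk.support_cons, List.mem_cons, Sum.inl.injEq, reduceCtorEq,
        false_or] at hz
      rcases hz with rfl | hz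
      · exact ⟨0, by omega, rfl⟩
      · obtain ⟨i, hi, rfl⟩ := hl z hz
        exact ⟨i + 1, by omega, rfl⟩

/-- Alternating paths from a driver node are the sequences of alternating steps. -/
lemma IsPairing.exists_alternatingPath_iff {G : Digraph V} {D : Set V} {m : V → V}
    (h : IsPairing G D m) {u v : V} (hu : u ∈ D) :
    (∃ p : (bipartiteRep G).Walk (Sum.inr u) (Sum.inr v),
      IsAlternatingPath (pairingEdges D m) p) ↔ ReflTransGen (AltStep G D m) u v := by
  constructor
  · rintro ⟨p, hp⟩
    -- No matching edge meets `u⁻`, so the path starts outside the matching.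
    refine (reflTransGen_of_walk p hp.2 rfl).1 u rfl ?_
    intro e he hmem
    obtain ⟨w, hw, rfl⟩ := hmem
    cases p with
    | nil => simp at he
    | cons hadj q =>
      simp only [SimpleGraph.Walk.edges_cons, List.head?_cons, Option.mem_def,
        Option.some.injEq] at he
      rcases Sym2.eq_iff.1 he with ⟨h1, -⟩ | ⟨h1, -⟩
      · cases h1
      · cases h1; exact hw hu
  · intro huv
    obtain ⟨n, p, rfl, rfl, hp, hinj⟩ := exists_injOn_of_reflTransGen huv
    obtain ⟨q, hq, -⟩ := h.exists_walk n p hp hinj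
    exact ⟨q, hq⟩

/-! ### Cross-layer augmentation -/

/-- The steps of a cross-layer augmenting path, on nodes labelled by the current layer: an
alternating step of the first layer, a reversed alternating step of the second one, or a change of
layer at a node which is a driver in both layers or in none. -/
def CrossStep (G₁ G₂ : Digraph V) (D₁ D₂ : Set V) (m₁ m₂ : V → V) : V × Layer → V × Layer → Prop
  | (x, .one), (y, .one) => AltStep G₁ D₁ m₁ x y
  | (x, .two), (y, .two) => AltStep G₂ D₂ m₂ y x
  | (x, .one), (y, .two) => x = y ∧ x ∉ D₁ ∧ x ∉ D₂
  | (x, .two), (y, .one) => x = y ∧ x ∈ D₁ ∧ x ∈ D₂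

/-- Augmenting both layers along a cross-layer sequence of steps. -/
lemma exists_augmented_pairings [Finite V] {G₁ G₂ : Digraph V} {D₁ D₂ : Set V} {m₁ m₂ : V → V}
    (h₁ : IsPairing G₁ D₁ m₁) (h₂ : IsPairing G₂ D₂ m₂) {a b : V} {ℓ ℓ' : Layer}
    (ha : a ∈ D₁ \ D₂) (hb : b ∈ D₂ \ D₁)
    (hab : ReflTransGen (CrossStep G₁ G₂ D₁ D₂ m₁ m₂) (a, ℓ) (b, ℓ')) :
    ∃ D₁' m₁' D₂' m₂', IsPairing G₁ D₁' m₁' ∧ IsPairing G₂ D₂' m₂' ∧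
      D₁'.ncard = D₁.ncard ∧ D₂'.ncard = D₂.ncard ∧ D₁' \ D₂' ⊆ (D₁ \ D₂) \ {a} := by
  obtain ⟨n, p, h0, hn, hp, hinj⟩ := exists_injOn_of_reflTransGen hab
  have out1 : ∀ i ≤ n, ∀ x, p i = (x, .one) → (i = n ∧ x ∈ D₂ ∧ x ∉ D₁) ∨
      (i < n ∧ ∃ y, p (i + 1) = (y, .one)) ∨
      (i < n ∧ p (i + 1) = (x, .two) ∧ x ∉ D₁ ∧ x ∉ D₂) := by
    intro i hi x hx
    rcases hi.lt_or_eq with hi | rfl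
    · right
      have := hp i hi
      rw [hx] at this
      rcases hq : p (i + 1) with ⟨y, _ | _⟩
      · exact Or.inl ⟨hi, y, rfl⟩
      · rw [hq] at this
        obtain ⟨rfl, h⟩ := this
        exact Or.inr ⟨hi, rfl, h⟩
    · left
      rw [hn] at hx
      cases hx
      exact ⟨rfl, hb⟩
  have out2 : ∀ i ≤ n, ∀ x, p i = (x, .two) → (i = n ∧ x ∈ D₂ ∧ x ∉ D₁) ∨
      (i < n ∧ (∃ y, p (i + 1) = (y, .two)) ∧ x ∉ D₂) ∨
      (i < n ∧ p (i + 1) = (x, .one) ∧ x ∈ D₁ ∧ x ∈ D₂) := by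
    intro i hi x hx
    rcases hi.lt_or_eq with hi | rfl
    · right
      have := hp i hi
      rw [hx] at this
      rcases hq : p (i + 1) with ⟨y, _ | _⟩
      · rw [hq] at this
        obtain ⟨rfl, h⟩ := this
        exact Or.inr ⟨hi, rfl, h⟩
      · rw [hq] at this
        exact Or.inl ⟨hi, ⟨y, rfl⟩, this.1⟩
    · left
      rw [hn] at hx
      cases hx
      exact ⟨rfl, hb⟩
  have step1 : ∀ i < n, ∀ x y, p i = (x, .one) → p (i + 1) = (y, .one) →
      AltStep G₁ D₁ m₁ x y := by
    intro i hi x y hx hy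
    have := hp i hi
    rwa [hx, hy] at this
  have step2 : ∀ i < n, ∀ x y, p i = (x, .two) → p (i + 1) = (y, .two) →
      AltStep G₂ D₂ m₂ y x := by
    intro i hi x y hx hy
    have := hp i hi
    rwa [hx, hy] at this
  have next : ∀ i < n, ∀ j < n, p i = p j → p (i + 1) = p (j + 1) := by
    intro i hi j hj hij
    rw [hinj i hi.le j hj.le hij]
  have prev : ∀ i < n, ∀ j < n, p (i + 1) = p (j + 1) → p i = p j := by
    intro i hi j hj hij
    have := hinj (i + 1) hi (j + 1) hj hij
    rw [show i = j by omega]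
  obtain ⟨m₁', hm₁', hcard₁, -⟩ := h₁.exchange
    (fun x y => ∃ i < n, p i = (x, .one) ∧ p (i + 1) = (y, .one))
    (by
      rintro x y y' ⟨i, hi, hx, hy⟩ ⟨j, hj, hx', hy'⟩
      have := next i hi j hj (hx.trans hx'.symm)
      rw [hy, hy'] at this
      exact (Prod.mk.inj this).1)
    (by
      rintro x x' y ⟨i, hi, hx, hy⟩ ⟨j, hj, hx', hy'⟩
      have := prev i hi j hj (hy.trans hy'.symm)
      rw [hx, hx'] at this
      exact (Prod.mk.inj this).1)
    (by
      rintro x y ⟨i, hi, hx, hy⟩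
      exact step1 i hi x y hx hy)
    (by
      rintro x y ⟨i, hi, hx, hy⟩
      rcases i with _ | i
      · rw [h0] at hx
        cases hx
        exact Or.inl ha.1
      · rcases hq : p i with ⟨z, _ | _⟩
        · exact Or.inr ⟨z, i, by omega, hq, hx⟩
        · have := hp i (by omega)
          rw [hq, hx] at this
          obtain ⟨rfl, h, -⟩ := this
          exact Or.inl h)
  -- The path runs against the alternating steps of layer 2, so the relation exchanged there is the
  -- path reversed.
  obtain ⟨m₂', hm₂', hcard₂, -⟩ := h₂.exchange
    (fun x y => ∃ i < n, p i = (y, .two) ∧ p (i + 1) = (x, .two))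
    (by
      rintro x y y' ⟨i, hi, hy, hx⟩ ⟨j, hj, hy', hx'⟩
      have := prev i hi j hj (hx.trans hx'.symm)
      rw [hy, hy'] at this
      exact (Prod.mk.inj this).1)
    (by
      rintro x x' y ⟨i, hi, hy, hx⟩ ⟨j, hj, hy', hx'⟩
      have := next i hi j hj (hy.trans hy'.symm)
      rw [hx, hx'] at this
      exact (Prod.mk.inj this).1)
    (by
      rintro x y ⟨i, hi, hy, hx⟩
      exact step2 i hi y x hy hx)
    (by
      rintro x y ⟨i, hi, hy, hx⟩
      rcases out2 (i + 1) hi x hx with h | ⟨hi', ⟨z, hz⟩, -⟩ | ⟨-, -, -, h⟩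
      · exact Or.inl h.2.1
      · exact Or.inr ⟨z, i + 1, hi', hx, hz⟩
      · exact Or.inl h)
  refine ⟨_, m₁', _, m₂', hm₁', hm₂', hcard₁, hcard₂, ?_⟩
  rintro x ⟨⟨hx1, hS1⟩, hx2⟩
  have hx2' : (∃ j < n, (∃ y, p j = (y, .two)) ∧ p (j + 1) = (x, .two)) ∨
      (x ∉ D₂ ∧ ¬ ∃ j < n, p j = (x, .two) ∧ ∃ y, p (j + 1) = (y, .two)) := by
    by_cases hS : ∃ j < n, (∃ y, p j = (y, .two)) ∧ p (j + 1) = (x, .two)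
    · exact Or.inl hS
    · right
      constructor
      · intro h
        refine hx2 ⟨Or.inl h, ?_⟩
        rintro ⟨y, i, hi, hy', hy⟩
        exact hS ⟨i, hi, ⟨y, hy'⟩, hy⟩
      · rintro ⟨j, hj, hjx, y, hy⟩
        refine hx2 ⟨Or.inr ⟨y, j, hj, hjx, hy⟩, ?_⟩
        rintro ⟨y, i, hi, hy', hy⟩
        exact hS ⟨i, hi, ⟨y, hy'⟩, hy⟩
  have hxS : ∀ i ≤ n, p i = (x, .one) → (i = n ∧ x ∈ D₂ ∧ x ∉ D₁) ∨
      (i < n ∧ p (i + 1) = (x, .two) ∧ x ∉ D₁ ∧ x ∉ D₂) := by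
    intro i hi hx
    rcases out1 i hi x hx with h | ⟨hi, y, hy⟩ | h
    · exact Or.inl h
    · exact absurd ⟨y, i, hi, hx, hy⟩ hS1
    · exact Or.inr h
  -- A surviving driver of layer 1 is never visited with label `one`, and this excludes `a`. A new
  -- driver of layer 1 is where the path ends or changes to layer 2, and there it is a driver of the
  -- new layer 2 as well.
  rcases hx1 with hx1 | ⟨z, i, hi, hz, hx⟩
  · have hxS' : ∀ i ≤ n, p i ≠ (x, .one) := by
      intro i hi hx
      rcases hxS i hi hx with ⟨-, -, h⟩ | ⟨-, -, h, -⟩ <;> exact h hx1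
    have hxa : x ≠ a → x ∉ D₂ → x ∈ (D₁ \ D₂) \ {a} := fun h h' => ⟨⟨hx1, h'⟩, h⟩
    rcases hx2' with ⟨j, hj, -, hjx⟩ | ⟨hx2', hT2⟩
    · rcases out2 (j + 1) hj x hjx with ⟨-, -, h⟩ | ⟨-, -, h⟩ | ⟨hj', h, -⟩
      · exact absurd hx1 h
      · refine hxa ?_ h
        rintro rfl
        cases ℓ
        · exact hxS' 0 (Nat.zero_le _) h0
        · have := hinj (j + 1) hj 0 (Nat.zero_le _) (hjx.trans h0.symm)
          omega
      · exact absurd h (hxS' _ hj')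
    · refine hxa ?_ hx2'
      rintro rfl
      cases ℓ
      · exact hxS' 0 (Nat.zero_le _) h0
      · rcases out2 0 (Nat.zero_le _) x h0 with ⟨-, h, -⟩ | ⟨hn0, ⟨y, hy⟩, -⟩ | ⟨-, -, -, h⟩
        · exact hx2' h
        · exact hT2 ⟨0, hn0, h0, y, hy⟩
        · exact hx2' h
  · exfalso
    have hx1 := (step1 i hi z x hz hx).1
    rcases hxS (i + 1) hi hx with ⟨hin, h, -⟩ | ⟨hin, hx', -, h⟩
    · rcases hx2' with ⟨j, hj, -, hjx⟩ | ⟨hx2', -⟩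
      · rcases out2 (j + 1) hj x hjx with ⟨hjn, -⟩ | ⟨-, -, h'⟩ | ⟨-, -, h', -⟩
        · rw [hjn, ← hin, hx] at hjx
          cases hjx
        · exact h' h
        · exact hx1 h'
      · exact hx2' h
    · rcases hx2' with ⟨j, hj, ⟨y, hy⟩, hjx⟩ | ⟨-, hT2⟩
      · have := prev j hj (i + 1) hin (hjx.trans hx'.symm)
        rw [hy, hx] at this
        cases this
      · rcases out2 (i + 1 + 1) hin x hx' with ⟨-, h', -⟩ | ⟨hi', ⟨y, hy⟩, -⟩ | ⟨-, -, h', -⟩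
        · exact h h'
        · exact hT2 ⟨i + 1 + 1, hi', hx', y, hy⟩
        · exact hx1 h'

lemma not_existsCLAP_of_diffMassMinimal [Finite V] {G₁ G₂ : Digraph V} {k₁ k₂ : ℕ}
    {M₁ M₂ : Set (Sym2 (V ⊕ V))} (hM₁ : M₁ ∈ feasibleSet G₁ k₁) (hM₂ : M₂ ∈ feasibleSet G₂ k₂)
    (hmin : DiffMassMinimal G₁ G₂ k₁ k₂ M₁ M₂) : ¬ ExistsCLAP G₁ G₂ M₁ M₂ := by
  rintro ⟨k, v, ℓ, hv⟩
  obtain ⟨hM₁', hk₁⟩ := mem_feasibleSet_iff.1 hM₁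
  obtain ⟨hM₂', hk₂⟩ := mem_feasibleSet_iff.1 hM₂
  obtain ⟨m₁, hm₁, e₁⟩ := hM₁'.exists_pairing
  obtain ⟨m₂, hm₂, e₂⟩ := hM₂'.exists_pairing
  have hseg1 : ∀ i, ℓ i = .one → v i.castSucc ∈ driverSet M₁ ∧ v i.succ ∉ driverSet M₁ ∧
      ReflTransGen (AltStep G₁ (driverSet M₁) m₁) (v i.castSucc) (v i.succ) := by
    intro i hi
    have h := hv.segment i
    rw [hi] at h
    obtain ⟨h1, h2, q, hq⟩ := h
    rw [e₁] at hq
    exact ⟨h1, h2, (hm₁.exists_alternatingPath_iff h1).1 ⟨q, hq⟩⟩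
  have hseg2 : ∀ i, ℓ i = .two → v i.castSucc ∉ driverSet M₂ ∧ v i.succ ∈ driverSet M₂ ∧
      ReflTransGen (AltStep G₂ (driverSet M₂) m₂) (v i.succ) (v i.castSucc) := by
    intro i hi
    have h := hv.segment i
    rw [hi] at h
    obtain ⟨h1, h2, q, hq⟩ := h
    rw [e₂] at hq
    exact ⟨h1, h2, (hm₂.exists_alternatingPath_iff h2).1 ⟨q.reverse, hq.reverse⟩⟩
  set R := CrossStep G₁ G₂ (driverSet M₁) (driverSet M₂) m₁ m₂
  have hlift : ∀ i, ReflTransGen R (v i.castSucc, ℓ i) (v i.succ, ℓ i) := by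
    intro i
    rcases hi : ℓ i
    · exact (hseg1 i hi).2.2.lift (fun x => (x, Layer.one)) fun a b h => h
    · exact (reflTransGen_swap.2 (hseg2 i hi).2.2).lift (fun x => (x, Layer.two)) fun a b h => h
  have hpath : ∀ (i : ℕ) (hi : i < k),
      ReflTransGen R (v 0, ℓ ⟨0, by omega⟩) (v (Fin.succ ⟨i, hi⟩), ℓ ⟨i, hi⟩) := by
    intro i
    induction i with
    | zero => exact fun hi => hlift ⟨0, hi⟩
    | succ i ih =>
      intro hi
      refine ((ih (by omega)).tail (b := (v (Fin.succ ⟨i, by omega⟩), ℓ ⟨i, by omega⟩))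
        (c := (v (Fin.castSucc ⟨i + 1, hi⟩), ℓ ⟨i + 1, hi⟩)) ?_).trans (hlift ⟨i + 1, hi⟩)
      have hne := hv.alternating ⟨i, by omega⟩ ⟨i + 1, hi⟩ rfl
      have hveq : v (Fin.succ ⟨i, by omega⟩) = v (Fin.castSucc ⟨i + 1, hi⟩) := rfl
      -- The endpoint conditions of the two segments put their common node in neither driver set or
      -- in both, as a change of layer requires.
      rcases h1 : ℓ ⟨i, by omega⟩ <;> rcases h2 : ℓ ⟨i + 1, hi⟩
      · exact absurd (h1.trans h2.symm) hne
      · exact ⟨hveq, (hseg1 _ h1).2.1, hveq ▸ (hseg2 _ h2).1⟩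
      · exact ⟨hveq, hveq ▸ (hseg1 _ h2).1, (hseg2 _ h1).2.1⟩
      · exact absurd (h1.trans h2.symm) hne
  have hk : 0 < k := by
    rcases Nat.eq_zero_or_pos k with rfl | hk
    · exact absurd hv.start_mem.1 hv.end_mem.2
    · exact hk
  have hlast : v (Fin.succ ⟨k - 1, by omega⟩) = v (Fin.last k) :=
    congrArg v (Fin.ext (Nat.sub_add_cancel hk))
  obtain ⟨D₁', m₁', D₂', m₂', h₁, h₂, c₁, c₂, hsub⟩ := exists_augmented_pairings hm₁ hm₂
    hv.start_mem hv.end_mem (hlast ▸ hpath (k - 1) (by omega))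
  have hle : diffMass M₁ M₂ ≤ diffMass (pairingEdges D₁' m₁') (pairingEdges D₂' m₂') := by
    refine hmin (a := (pairingEdges D₁' m₁', pairingEdges D₂' m₂')) ⟨?_, ?_⟩
    · rw [← hk₁, ← c₁]; exact h₁.mem_feasibleSet
    · rw [← hk₂, ← c₂]; exact h₂.mem_feasibleSet
  simp only [diffMass, DD₁, DD₂, driverSet_pairingEdges] at hle
  have hlt : (D₁' \ D₂').ncard < (driverSet M₁ \ driverSet M₂).ncard :=
    (Set.ncard_le_ncard hsub (Set.toFinite _)).trans_lt
      (Set.ncard_sdiff_singleton_lt_of_mem hv.start_mem)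
  -- As `|D₁|` and `|D₂|` are unchanged, `|D₂ \ D₁|` falls by as much as `|D₁ \ D₂|`.
  have i1 := Set.ncard_inter_add_ncard_sdiff_eq_ncard (driverSet M₁) (driverSet M₂)
  have i2 := Set.ncard_inter_add_ncard_sdiff_eq_ncard (driverSet M₂) (driverSet M₁)
  have i3 := Set.ncard_inter_add_ncard_sdiff_eq_ncard D₁' D₂'
  have i4 := Set.ncard_inter_add_ncard_sdiff_eq_ncard D₂' D₁'
  rw [Set.inter_comm] at i2 i4
  omega

lemma diffMassMinimal_iff_unionMinimal [Finite V] {G₁ G₂ : Digraph V} {k₁ k₂ : ℕ}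
    {M₁ M₂ : Set (Sym2 (V ⊕ V))} (hM₁ : M₁ ∈ feasibleSet G₁ k₁) (hM₂ : M₂ ∈ feasibleSet G₂ k₂) :
    DiffMassMinimal G₁ G₂ k₁ k₂ M₁ M₂ ↔ UnionMinimal G₁ G₂ k₁ k₂ M₁ M₂ := by
  have key : ∀ S ∈ feasibleSet G₁ k₁ ×ˢ feasibleSet G₂ k₂,
      2 * (unionDriverSet S.1 S.2).ncard = diffMass S.1 S.2 + (k₁ + k₂) := by
    rintro ⟨N₁, N₂⟩ ⟨h₁, h₂⟩
    have h₁ := (mem_feasibleSet_iff.1 h₁).2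
    have h₂ := (mem_feasibleSet_iff.1 h₂).2
    have i1 := Set.ncard_inter_add_ncard_sdiff_eq_ncard (driverSet N₁) (driverSet N₂)
    have i2 := Set.ncard_inter_add_ncard_sdiff_eq_ncard (driverSet N₂) (driverSet N₁)
    have i3 := Set.ncard_union_add_ncard_inter (driverSet N₁) (driverSet N₂)
    rw [Set.inter_comm] at i2
    simp only [diffMass, DD₁, DD₂, unionDriverSet] at *
    omega
  have k0 := key (M₁, M₂) ⟨hM₁, hM₂⟩
  constructor
  · intro h S hS
    have h1 : diffMass M₁ M₂ ≤ diffMass S.1 S.2 := h hS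
    have h2 := key S hS
    change (unionDriverSet M₁ M₂).ncard ≤ (unionDriverSet S.1 S.2).ncard
    simp only at k0
    omega
  · intro h S hS
    have h1 : (unionDriverSet M₁ M₂).ncard ≤ (unionDriverSet S.1 S.2).ncard := h hS
    have h2 := key S hS
    change diffMass M₁ M₂ ≤ diffMass S.1 S.2
    simp only at k0
    omega

/-! ### Optimality at minimum budgets -/

/-- A sequence of admissible segments between the two difference sets gives a cross-layer
augmenting path: the alternation of the layers is automatic. -/
lemma existsCLAP_of_reflTransGen {G₁ G₂ : Digraph V} {M₁ M₂ : Set (Sym2 (V ⊕ V))} {a b : V}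
    (ha : a ∈ DD₁ M₁ M₂) (hb : b ∈ DD₂ M₁ M₂)
    (hab : ReflTransGen (fun u v => ∃ ℓ, AdmissibleSegment G₁ G₂ M₁ M₂ ℓ u v) a b) :
    ExistsCLAP G₁ G₂ M₁ M₂ := by
  obtain ⟨n, p, h0, hn, hp, hinj⟩ := exists_injOn_of_reflTransGen hab
  choose ℓ hℓ using fun i : Fin n => hp i i.2
  refine ⟨n, fun i => p i, ℓ, ⟨hℓ, ?_, ?_, ?_, ?_⟩⟩
  · simpa [h0] using ha
  · simpa [hn] using hb
  · intro i j hij heq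
    have h1 := hℓ i
    have h2 := hℓ j
    rw [heq, hij] at h1
    rcases hj : ℓ j <;> rw [hj] at h1 h2
    · exact h1.2.1 h2.1
    · exact h2.1 h1.2.1
  · intro i j hij
    exact Fin.ext (hinj i (by omega) j (by omega) hij)

lemma IsMinimumBudget.le_ncard [Finite V] {G : Digraph V} {k : ℕ} (hk : IsMinimumBudget G k)
    {D : Set V} {m : V → V} (h : IsPairing G D m) : k ≤ D.ncard := by
  obtain ⟨M, hM, hMk⟩ := hk
  have h1 := hM.2 _ h.isMatching
  have h2 := h.isMatching.ncard_add_ncard_driverSet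
  rw [driverSet_pairingEdges] at h2
  omega

lemma diffMassMinimal_of_not_existsCLAP [Finite V] {G₁ G₂ : Digraph V} {k₁ k₂ : ℕ}
    {M₁ M₂ : Set (Sym2 (V ⊕ V))} (hM₁ : M₁ ∈ feasibleSet G₁ k₁) (hM₂ : M₂ ∈ feasibleSet G₂ k₂)
    (hk₁ : IsMinimumBudget G₁ k₁) (hk₂ : IsMinimumBudget G₂ k₂)
    (hC : ¬ ExistsCLAP G₁ G₂ M₁ M₂) : DiffMassMinimal G₁ G₂ k₁ k₂ M₁ M₂ := by
  rintro ⟨N₁, N₂⟩ ⟨hN₁, hN₂⟩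
  obtain ⟨hM₁, d₁⟩ := mem_feasibleSet_iff.1 hM₁
  obtain ⟨hM₂, d₂⟩ := mem_feasibleSet_iff.1 hM₂
  obtain ⟨hN₁, d₁'⟩ := mem_feasibleSet_iff.1 hN₁
  obtain ⟨hN₂, d₂'⟩ := mem_feasibleSet_iff.1 hN₂
  obtain ⟨m₁, hm₁, e₁⟩ := hM₁.exists_pairing
  obtain ⟨m₂, hm₂, e₂⟩ := hM₂.exists_pairing
  obtain ⟨n₁, hn₁, -⟩ := hN₁.exists_pairing
  obtain ⟨n₂, hn₂, -⟩ := hN₂.exists_pairing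
  set X : Set V := {v | ∃ a ∈ DD₁ M₁ M₂,
    ReflTransGen (fun u v => ∃ ℓ, AdmissibleSegment G₁ G₂ M₁ M₂ ℓ u v) a v}
  have hstep : ∀ u ∈ X, ∀ v ℓ, AdmissibleSegment G₁ G₂ M₁ M₂ ℓ u v → v ∈ X := by
    rintro u ⟨a, ha, hau⟩ v ℓ h
    exact ⟨a, ha, hau.tail ⟨ℓ, h⟩⟩
  have hX₁ : (driverSet M₁ ∩ X).ncard ≤ (driverSet N₁ ∩ X).ncard := by
    refine hm₁.ncard_inter_le (fun D' m' h => d₁ ▸ hk₁.le_ncard h) ?_ hn₁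
    intro u hu huX v hv huv
    have := (hm₁.exists_alternatingPath_iff hu).2 huv
    rw [← e₁] at this
    exact hstep u huX v .one ⟨hu, hv, this⟩
  -- Layer-2 segments run towards drivers, so closure of `X` under them is closure of `Xᶜ` under
  -- alternating paths from drivers.
  have hX₂ : (driverSet M₂ ∩ Xᶜ).ncard ≤ (driverSet N₂ ∩ Xᶜ).ncard := by
    refine hm₂.ncard_inter_le (fun D' m' h => d₂ ▸ hk₂.le_ncard h) ?_ hn₂
    intro u hu huX v hv huv hvX
    obtain ⟨q, hq⟩ := (hm₂.exists_alternatingPath_iff hu).2 huv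
    rw [← e₂] at hq
    exact huX (hstep v hvX u .two ⟨hv, hu, q.reverse, hq.reverse⟩)
  have hDD₁ : DD₁ M₁ M₂ ⊆ driverSet M₁ ∩ X := fun a ha => ⟨ha.1, a, ha, .refl⟩
  have hDD₂ : DD₂ M₁ M₂ ⊆ driverSet M₂ ∩ Xᶜ := fun b hb =>
    ⟨hb.1, fun ⟨_, ha, hab⟩ => hC (existsCLAP_of_reflTransGen ha hb hab)⟩
  -- Both layer-2 driver sets have `k₂` elements, so the bound on `Xᶜ` turns into `|D(N₂) ∩ X| ≤
  -- |D(M₂) ∩ X|`.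
  have f₁ := Set.ncard_inter_add_ncard_sdiff_eq_ncard (driverSet M₂) X
  have f₂ := Set.ncard_inter_add_ncard_sdiff_eq_ncard (driverSet N₂) X
  have f₃ : (driverSet N₁ ∩ X).ncard ≤
      (driverSet N₁ \ driverSet N₂).ncard + (driverSet N₂ ∩ X).ncard := by
    refine (Set.ncard_le_ncard ?_ (Set.toFinite _)).trans (Set.ncard_union_le _ _)
    rintro x ⟨hx, hxX⟩
    by_cases h : x ∈ driverSet N₂
    · exact Or.inr ⟨h, hxX⟩
    · exact Or.inl ⟨hx, h⟩
  -- Since `X` misses `DD₂`, drivers of layer 2 in `X` are drivers of layer 1.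
  have f₄ : (DD₁ M₁ M₂).ncard + (driverSet M₂ ∩ X).ncard ≤ (driverSet M₁ ∩ X).ncard := by
    rw [← Set.ncard_union_eq (Set.disjoint_left.2 fun x hx hx' => hx.2 hx'.1) (Set.toFinite _)
      (Set.toFinite _)]
    refine Set.ncard_le_ncard (Set.union_subset hDD₁ ?_) (Set.toFinite _)
    rintro x ⟨hx, hxX⟩
    exact ⟨by_contra fun h => (hDD₂ ⟨hx, h⟩).2 hxX, hxX⟩
  have i₁ := Set.ncard_inter_add_ncard_sdiff_eq_ncard (driverSet M₁) (driverSet M₂)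
  have i₂ := Set.ncard_inter_add_ncard_sdiff_eq_ncard (driverSet M₂) (driverSet M₁)
  have i₃ := Set.ncard_inter_add_ncard_sdiff_eq_ncard (driverSet N₁) (driverSet N₂)
  have i₄ := Set.ncard_inter_add_ncard_sdiff_eq_ncard (driverSet N₂) (driverSet N₁)
  rw [Set.inter_comm] at i₂ i₄
  change diffMass M₁ M₂ ≤ diffMass N₁ N₂
  simp only [diffMass, DD₁, DD₂, Set.sdiff_eq] at *
  omega

end Duplex

theorem mainTheorem1 {V : Type*} [Finite V] (G₁ G₂ : Digraph V) (k₁ k₂ : ℕ)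
    (M₁ M₂ : Set (Sym2 (V ⊕ V)))
    (hM₁ : M₁ ∈ Duplex.feasibleSet G₁ k₁) (hM₂ : M₂ ∈ Duplex.feasibleSet G₂ k₂) :
    (Duplex.IsMinimumBudget G₁ k₁ → Duplex.IsMinimumBudget G₂ k₂ →
      List.TFAE [¬ Duplex.ExistsCLAP G₁ G₂ M₁ M₂,
        Duplex.DiffMassMinimal G₁ G₂ k₁ k₂ M₁ M₂,
        Duplex.UnionMinimal G₁ G₂ k₁ k₂ M₁ M₂]) ∧
    (Duplex.DiffMassMinimal G₁ G₂ k₁ k₂ M₁ M₂ ↔ Duplex.UnionMinimal G₁ G₂ k₁ k₂ M₁ M₂) ∧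
    (Duplex.DiffMassMinimal G₁ G₂ k₁ k₂ M₁ M₂ → ¬ Duplex.ExistsCLAP G₁ G₂ M₁ M₂) := by
  have h23 := Duplex.diffMassMinimal_iff_unionMinimal hM₁ hM₂
  have h21 := Duplex.not_existsCLAP_of_diffMassMinimal hM₁ hM₂
  refine ⟨fun hk₁ hk₂ => ?_, h23, h21⟩
  tfae_have 1 → 2 := Duplex.diffMassMinimal_of_not_existsCLAP hM₁ hM₂ hk₁ hk₂
  tfae_have 2 → 1 := h21
  tfae_have 2 ↔ 3 := h23
  tfae_finish
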